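/- Let $n,s\ge 1$ be integers. **Nef weight pairs.** A fake weighted projective space $Z$ of dimension $n$ is the toric variety whose fan is spanned by the faces of a lattice simplex in $\mathbb{R}^n$ with primitive vertices $v_0,\dots,v_n\in\mathbb{Z}^n$ and the origin in its interior. Let $P=[v_0,\dots,v_n]$, $\mathrm{Cl}(Z)=\mathbb{Z}^{n+1}/\mathrm{im}(P^{T})$, let $\omega_i\in\mathrm{Cl}(Z)$ be the class of the $i$-th unit vector, and let $\mathrm{Pic}(Z)\subseteq\mathrm{Cl}(Z)$ be the subgroup of Cartier classes. A *nef-partition* of $Z$ into $s$ blocks is an (unordered) partition of $\{0,\dots,n\}$ into $s$ nonempty blocks such that, for every block $b$, $\sum_{i\in b}\omega_i\in\mathrm{Pic}(Z)$ and $\sum_{i\in b}\omega_i\neq\omega_j$ for all $j=0,\dots,n$. A vector of integers $w=(w_0,\dots,w_n)$ with $1\le w_0\le\dots\le w_n$ is an *$s$-nef weight vector* if there are a fake weighted projective space $Z$ with a nef-partition into $s$ blocks and an isomorphism $\mathrm{Cl}(Z)\cong\mathbb{Z}$ taking $\omega_i$ to $w_i$ for all $i$; then $p(s,w)$ denotes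 the set of all nef-partitions of $Z$ into $s$ blocks, and $(w,p(s,w))$ is called an *$s$-nef weight pair*. **Procedure.** A tuple of positive integers is called primitive if the greatest common divisor of its entries is $1$. 1. For $2\le k\le n+1$ let $\mathcal{W}_k$ be the set of primitive non-decreasing $k$-tuples $(x_1,\dots,x_k)$ of positive integers with $\mathrm{lcm}(x_1,\dots,x_k)\mid x_1+\dots+x_k$. 2. Let $\mathcal{D}$ be the set of non-increasing $s$-tuples $(d_1,\dots,d_s)$ of integers $d_i\ge 2$ with $\sum_i d_i=n+1$. 3. For each $(d_1,\dots,d_s)\in\mathcal{D}$, form all $s$-tuples $(W_1,\dots,W_s)$ with $W_i\in\mathcal{W}_{d_i}$ such that for every $i<s$ either $d_i>d_{i+1}$ or $W_i\ge_{\mathrm{lex}}W_{i+1}$. 4. Let $L_i,S_i,m_i$ be the least common multiple, the sum and the maximum of the entries of $W_i$. Let $\mathcal{C}(W_1,\dots,W_s)$ be the set of primitive $s$-tuples $(c_1,\dots,c_s)$ of positive integers such that (a) $c_1\mid\mathrm{lcm}(S_2,\dots,S_s)$ (where the empty lcm is $1$), (b) $c_iL_i\mid c_jS_j$ for all $i,j$,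 and (c) $c_iS_i>c_jm_j$ for all $i,j$. 5. For all such $(W_1,\dots,W_s)$ and $(c_1,\dots,c_s)$, let $w=(w_0,\dots,w_n)$ be the non-decreasing reordering of the concatenation of $c_1W_1,\dots,c_sW_s$, and store $w$ with every partition of $\{0,\dots,n\}$ whose blocks can be labelled $p_1,\dots,p_s$ so that, for each $i$, the multiset $\{w_j : j\in p_i\}$ is the multiset of entries of $c_iW_i$. 6. For every stored $w$, let $q(s,w)$ be the set of all partitions stored with $w$, and return $(w,q(s,w))$. **Claim.** All the sets formed in the procedure (each $\mathcal{W}_k$ for $2\le k\le n+1$, $\mathcal{D}$, each set of tuples $(W_1,\dots,W_s)$, each $\mathcal{C}(W_1,\dots,W_s)$) and the output are finite, and the set of pairs returned is exactly the set of all $s$-nef weight pairs $(w,p(s,w))$ with $w\in\mathbb{Z}_{\ge1}^{n+1}$. -/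

import Mathlib

open scoped Matrix

/-- A fake weighted projective space of dimension `n`, given by its fan: the fan is spanned by the
faces of a Fano simplex with vertices `v 0, …, v n` in `ℤ ^ n`, that is, a lattice simplex with
primitive vertices which contains the origin in its interior. -/
structure FakeWPS (n : ℕ) where
  /-- the vertices of the Fano simplex, i.e. the primitive generators of the rays of the fan -/
  v : Fin (n + 1) → Fin n → ℤ
  primitive : ∀ (i : Fin (n + 1)) (k : ℤ) (u : Fin n → ℤ), v i = k • u → IsUnit k
  affineIndependent : AffineIndependent ℝ (fun i => (fun a => (v i a : ℝ) : Fin n → ℝ))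
  zero_mem_interior :
    (0 : Fin n → ℝ) ∈
      interior (convexHull ℝ (Set.range fun i => (fun a => (v i a : ℝ) : Fin n → ℝ)))

namespace FakeWPS

variable {n : ℕ} (Z : FakeWPS n)

/-- The `n × (n + 1)` matrix whose columns are the vertices. -/
def P : Matrix (Fin n) (Fin (n + 1)) ℤ := Matrix.of fun a i => Z.v i a

/-- The divisor class group `ℤ ^ (n + 1) / im Pᵀ`: torus invariant Weil divisors modulo
divisors of characters. -/
abbrev Cl : Type := (Fin (n + 1) → ℤ) ⧸ LinearMap.range (Matrix.mulVecLin Z.Pᵀ)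

/-- The class `ω i` of the `i`-th torus invariant prime divisor. -/
def ω (i : Fin (n + 1)) : Z.Cl := Submodule.Quotient.mk (Pi.single i 1)

/-- The torus invariant Cartier divisors. The maximal cones are `σ j = cone (v i | i ≠ j)`, and
`∑ i, a i • D i` is Cartier iff on every affine chart it is the divisor of a character, i.e. for
every `j` there is a linear form `m` with `⟨m, v i⟩ = - a i` for all rays `v i` of `σ j`. -/
def cartierDivisors : Submodule ℤ (Fin (n + 1) → ℤ) where
  carrier := {a | ∀ j, ∃ m : Fin n → ℤ, ∀ i, i ≠ j → m ⬝ᵥ Z.v i = - a i}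
  zero_mem' := fun _ => ⟨0, fun _ _ => by simp⟩
  add_mem' := by
    intro a b ha hb j
    obtain ⟨m, hm⟩ := ha j
    obtain ⟨m', hm'⟩ := hb j
    refine ⟨m + m', fun i hi => ?_⟩
    rw [add_dotProduct, hm i hi, hm' i hi, Pi.add_apply, neg_add]
  smul_mem' := by
    intro k a ha j
    obtain ⟨m, hm⟩ := ha j
    refine ⟨k • m, fun i hi => ?_⟩
    rw [smul_dotProduct, hm i hi, Pi.smul_apply, smul_neg]

/-- The Picard group, as the subgroup of Cartier divisor classes in the class group. -/
def Pic : Submodule ℤ Z.Cl :=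
  Z.cartierDivisors.map (Submodule.mkQ (LinearMap.range (Matrix.mulVecLin Z.Pᵀ)))

/-- `w` is a degree matrix of `Z` with `Cl(Z) = ℤ`: under some isomorphism `Cl(Z) ≅ ℤ` the
classes `ω i` become the positive integers `w i`, listed in non-decreasing order. -/
def IsDegreeMatrix (w : Fin (n + 1) → ℕ) : Prop :=
  (∀ i, 1 ≤ w i) ∧ Monotone w ∧ ∃ φ : Z.Cl ≃ₗ[ℤ] ℤ, ∀ i, φ (Z.ω i) = (w i : ℤ)

/-- A partition of `{0, …, n}` is a nef-partition of `Z` if the sum of the `ω i` over each block is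
in the Picard group and is different from every single `ω i`. -/
def IsNefPartition (p : Finpartition (Finset.univ : Finset (Fin (n + 1)))) : Prop :=
  ∀ b ∈ p.parts, ∑ i ∈ b, Z.ω i ∈ Z.Pic ∧ ∀ i, ∑ j ∈ b, Z.ω j ≠ Z.ω i

/-- The set of all nef-partitions of `Z` into `s` blocks. -/
def nefPartitions (s : ℕ) : Set (Finpartition (Finset.univ : Finset (Fin (n + 1)))) :=
  {p | p.parts.card = s ∧ Z.IsNefPartition p}

end FakeWPS

/-- The set of all `s`-nef weight pairs `(w, p(s, w))` with `w` of length `n + 1`. -/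
def nefWeightPairs (n s : ℕ) :
    Set ((Fin (n + 1) → ℕ) × Set (Finpartition (Finset.univ : Finset (Fin (n + 1))))) :=
  {x | ∃ Z : FakeWPS n,
    Z.IsDegreeMatrix x.1 ∧ (Z.nefPartitions s).Nonempty ∧ x.2 = Z.nefPartitions s}

namespace NefProcedure

/-- The least common multiple of the entries. -/
def lcmOf (l : List ℕ) : ℕ := (l : Multiset ℕ).lcm

/-- The greatest common divisor of the entries. -/
def gcdOf (l : List ℕ) : ℕ := (l : Multiset ℕ).gcd

/-- The maximum of the entries. -/
def maxOf (l : List ℕ) : ℕ := (l : Multiset ℕ).sup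

/-- Step 1: primitive non-decreasing `k`-tuples of positive integers whose least common multiple
divides their sum. -/
def blocks (k : ℕ) : Set (List ℕ) :=
  {l | l.length = k ∧ (∀ x ∈ l, 1 ≤ x) ∧ l.Pairwise (· ≤ ·) ∧ gcdOf l = 1 ∧ lcmOf l ∣ l.sum}

/-- Step 2: non-increasing `s`-tuples of integers `≥ 2` with sum `n + 1`. -/
def sizes (n s : ℕ) : Set (Fin s → ℕ) :=
  {d | Antitone d ∧ (∀ i, 2 ≤ d i) ∧ ∑ i, d i = n + 1}

/-- Step 3: `s`-tuples of blocks of the given lengths, where consecutive blocks of equal length are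
in lexicographically non-increasing order (`≤` on lists is lexicographic). -/
def blockTuples {s : ℕ} (d : Fin s → ℕ) : Set (Fin s → List ℕ) :=
  {W | (∀ i, W i ∈ blocks (d i)) ∧
    ∀ i j : Fin s, (j : ℕ) = i + 1 → d j < d i ∨ W j ≤ W i}

/-- Step 4: primitive `s`-tuples of positive integers subject to the conditions (a), (b), (c).
The least common multiple of the empty family is `1`. -/
def multipliers {s : ℕ} (W : Fin s → List ℕ) : Set (Fin s → ℕ) :=
  {c | (∀ i, 1 ≤ c i) ∧ Finset.univ.gcd c = 1 ∧
    (∀ i : Fin s, (i : ℕ) = 0 → c i ∣ (Finset.univ.erase i).lcm fun j => (W j).sum) ∧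
    (∀ i j, c i * lcmOf (W i) ∣ c j * (W j).sum) ∧
    ∀ i j, c j * maxOf (W j) < c i * (W i).sum}

/-- The entries of `c i • W i`. -/
def scaledBlock {s : ℕ} (W : Fin s → List ℕ) (c : Fin s → ℕ) (i : Fin s) : Multiset ℕ :=
  ((W i).map (c i * ·) : List ℕ)

/-- Step 5: `w` is the non-decreasing reordering of the concatenation of the `c i • W i`, and `p` is
a partition whose blocks are the sets of indices corresponding to the elements of the `c i • W i`.
If `w` has repeated entries, all such correspondences are taken. -/
def Stores {n s : ℕ} (W : Fin s → List ℕ) (c : Fin s → ℕ) (w : Fin (n + 1) → ℕ)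
    (p : Finpartition (Finset.univ : Finset (Fin (n + 1)))) : Prop :=
  Monotone w ∧ (Finset.univ : Finset (Fin (n + 1))).val.map w = ∑ i, scaledBlock W c i ∧
    ∃ b : Fin s → Finset (Fin (n + 1)), Function.Injective b ∧ Finset.univ.image b = p.parts ∧
      ∀ i, (b i).val.map w = scaledBlock W c i

/-- Step 6: all the partitions stored together with `w`. -/
def q (n s : ℕ) (w : Fin (n + 1) → ℕ) :
    Set (Finpartition (Finset.univ : Finset (Fin (n + 1)))) :=
  {p | ∃ d ∈ sizes n s, ∃ W ∈ blockTuples d, ∃ c ∈ multipliers W, Stores W c w p}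

/-- The pairs `(w, q(s, w))`, where `w` runs through the stored vectors. -/
def output (n s : ℕ) :
    Set ((Fin (n + 1) → ℕ) × Set (Finpartition (Finset.univ : Finset (Fin (n + 1))))) :=
  {x | (q n s x.1).Nonempty ∧ x.2 = q n s x.1}

end NefProcedure

/-! An isomorphism Cl(Z) ≅ ℤ taking `ω i` to `w i` identifies the image of Pᵀ with the kernel of the
linear form `w`. A class is then Cartier iff its degree is divisible by every `w j`, so a partition
is nef iff every block sum is divisible by every weight and equal to none; for positive weights, the
sum is then strictly larger than each of them. The monotone positive vectors that occur are those in
which any `n` entries have gcd 1: primitivity of the vertices forces this (`isWellFormed_of_map`),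
and conversely a basis of the kernel of `w` supplies the rows of P (`IsWellFormed.exists_fakeWPS`).
So `mem_nefWeightPairs_iff` turns the claim into arithmetic.

The weights of a block are c • W with c their gcd and W primitive. Divisibility and strict
inequality become conditions (b) and (c), the case i = j of (b) puts W in `blocks`, and (a) follows
from (b) and primitivity of the multipliers. Conversely, stored vectors are well-formed because
every block has at least two entries.

For finiteness, a primitive block with sum S is determined by the numbers S / x, whose reciprocals
add up to 1. Condition (a) bounds the first multiplier, and (c) then bounds the others. -/

namespace FakeWPS

variable {n : ℕ}

/-- Any `n` of the `n + 1` weights have greatest common divisor one. -/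
def IsWellFormed (w : Fin (n + 1) → ℕ) : Prop :=
  ∀ (j : Fin (n + 1)) (k : ℕ), (∀ i, i ≠ j → k ∣ w i) → k = 1

/-! ### Cartier classes, nef-partitions and degrees -/

section ClassGroup

variable {Z : FakeWPS n} {w : Fin (n + 1) → ℕ} {φ : Z.Cl ≃ₗ[ℤ] ℤ}

theorem map_mk_eq_sum (hφ : ∀ i, φ (Z.ω i) = (w i : ℤ)) (a : Fin (n + 1) → ℤ) :
    φ (Submodule.Quotient.mk a) = ∑ i, a i * (w i : ℤ) := by
  have ha : (Submodule.Quotient.mk a : Z.Cl) = ∑ i, a i • Z.ω i := by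
    conv_lhs => rw [pi_eq_sum_univ' a]
    simp only [ω]
    rw [← Submodule.mkQ_apply, map_sum]
    refine Finset.sum_congr rfl fun i _ => ?_
    rw [map_smul, Submodule.mkQ_apply]
  rw [ha, map_sum]
  refine Finset.sum_congr rfl fun i _ => ?_
  rw [map_smul, hφ, smul_eq_mul]

theorem mem_range_transpose_iff (hφ : ∀ i, φ (Z.ω i) = (w i : ℤ)) (a : Fin (n + 1) → ℤ) :
    a ∈ LinearMap.range (Matrix.mulVecLin Z.Pᵀ) ↔ ∑ i, a i * (w i : ℤ) = 0 := by
  rw [← map_mk_eq_sum hφ, LinearEquiv.map_eq_zero_iff, Submodule.Quotient.mk_eq_zero]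

theorem mulVec_transpose_apply (Z : FakeWPS n) (m : Fin n → ℤ) (i : Fin (n + 1)) :
    (Z.Pᵀ *ᵥ m) i = m ⬝ᵥ Z.v i := by
  rw [dotProduct_comm]
  rfl

theorem range_le_cartierDivisors (Z : FakeWPS n) :
    LinearMap.range (Matrix.mulVecLin Z.Pᵀ) ≤ Z.cartierDivisors := by
  rintro _ ⟨m, rfl⟩ j
  refine ⟨-m, fun i _ => ?_⟩
  rw [Matrix.mulVecLin_apply, mulVec_transpose_apply, neg_dotProduct]

theorem mk_mem_Pic_iff (a : Fin (n + 1) → ℤ) :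
    (Submodule.Quotient.mk a : Z.Cl) ∈ Z.Pic ↔ a ∈ Z.cartierDivisors := by
  constructor
  · rintro ⟨b, hb, hba⟩
    have h : a - b ∈ Z.cartierDivisors :=
      range_le_cartierDivisors Z ((Submodule.Quotient.eq _).1 hba.symm)
    simpa using Z.cartierDivisors.add_mem h hb
  · exact fun h => ⟨a, h, rfl⟩

/-- Being principal on the chart of σ j means being linearly equivalent to a multiple of the divisor
D j, and those multiples have degrees in `w j`ℤ. -/
theorem mem_cartierDivisors_iff (hφ : ∀ i, φ (Z.ω i) = (w i : ℤ)) (a : Fin (n + 1) → ℤ) :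
    a ∈ Z.cartierDivisors ↔ ∀ j, (w j : ℤ) ∣ ∑ i, a i * (w i : ℤ) := by
  refine forall_congr' fun j => ⟨?_, ?_⟩
  · rintro ⟨m, hm⟩
    have h0 : ∑ i, (Z.Pᵀ *ᵥ m) i * (w i : ℤ) = 0 := (mem_range_transpose_iff hφ _).1 ⟨m, rfl⟩
    have h1 : ∑ i, (a i + (Z.Pᵀ *ᵥ m) i) * (w i : ℤ) = (a j + (Z.Pᵀ *ᵥ m) j) * w j := by
      refine Finset.sum_eq_single j (fun i _ hi => ?_) (by simp)
      rw [mulVec_transpose_apply, hm i hi, add_neg_cancel, zero_mul]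
    simp only [add_mul, Finset.sum_add_distrib, h0, add_zero] at h1
    rw [h1, ← add_mul]
    exact dvd_mul_left _ _
  · rintro ⟨t, ht⟩
    -- This divisor has degree zero, hence is the divisor of a character.
    have h : (Pi.single j t - a : Fin (n + 1) → ℤ) ∈ LinearMap.range (Matrix.mulVecLin Z.Pᵀ) := by
      rw [mem_range_transpose_iff hφ]
      simp only [Pi.sub_apply, sub_mul, Finset.sum_sub_distrib, ht]
      rw [Finset.sum_eq_single j (fun i _ hi => by simp [hi]) (by simp)]
      simp [mul_comm]
    obtain ⟨m, hm⟩ := h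
    refine ⟨m, fun i hi => ?_⟩
    rw [← mulVec_transpose_apply, ← Matrix.mulVecLin_apply, hm]
    simp [hi]

theorem mem_Pic_iff (hφ : ∀ i, φ (Z.ω i) = (w i : ℤ)) (x : Z.Cl) :
    x ∈ Z.Pic ↔ ∀ j, (w j : ℤ) ∣ φ x := by
  obtain ⟨a, rfl⟩ := Submodule.Quotient.mk_surjective _ x
  rw [mk_mem_Pic_iff, mem_cartierDivisors_iff hφ, map_mk_eq_sum hφ]

theorem isNefPartition_iff (hφ : ∀ i, φ (Z.ω i) = (w i : ℤ))
    (p : Finpartition (Finset.univ : Finset (Fin (n + 1)))) :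
    Z.IsNefPartition p ↔
      ∀ b ∈ p.parts, ∀ i, w i ∣ ∑ j ∈ b, w j ∧ ∑ j ∈ b, w j ≠ w i := by
  refine forall₂_congr fun b _ => ?_
  have hsum : φ (∑ i ∈ b, Z.ω i) = ((∑ i ∈ b, w i : ℕ) : ℤ) := by
    rw [map_sum, Nat.cast_sum]
    exact Finset.sum_congr rfl fun i _ => hφ i
  rw [mem_Pic_iff hφ, hsum, ← forall_and]
  refine forall_congr' fun i => and_congr (by norm_cast) (not_congr ?_)
  rw [← φ.injective.eq_iff, hsum, hφ]
  norm_cast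

theorem exists_dotProduct_eq_one (Z : FakeWPS n) (j : Fin (n + 1)) :
    ∃ m : Fin n → ℤ, m ⬝ᵥ Z.v j = 1 := by
  obtain ⟨g, hg⟩ := IsPrincipalIdealRing.principal (Ideal.span (Set.range (Z.v j)))
  have hdvd : ∀ a, g ∣ Z.v j a := fun a =>
    Ideal.mem_span_singleton.1 (hg.le <| Ideal.subset_span ⟨a, rfl⟩)
  choose u hu using hdvd
  have hunit : IsUnit g := Z.primitive j g u (funext fun a => by simp [hu a])
  have h1 : (1 : ℤ) ∈ Ideal.span (Set.range (Z.v j)) := by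
    rw [hg]
    exact Ideal.mem_span_singleton.2 hunit.dvd
  obtain ⟨m, hm⟩ := (Submodule.mem_span_range_iff_exists_fun ℤ).1 h1
  exact ⟨m, by simpa [dotProduct] using hm⟩

/-- A character taking the value 1 on `v j` gives a relation that writes `w j` as an integral
combination of the other weights. A common divisor of those divides all weights, hence divides 1 by
surjectivity of `φ`. -/
theorem isWellFormed_of_map (hφ : ∀ i, φ (Z.ω i) = (w i : ℤ)) : IsWellFormed w := by
  intro j k hk
  obtain ⟨m, hm⟩ := exists_dotProduct_eq_one Z j
  have h0 : ∑ i, (Z.Pᵀ *ᵥ m) i * (w i : ℤ) = 0 := (mem_range_transpose_iff hφ _).1 ⟨m, rfl⟩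
  rw [← Finset.add_sum_erase _ _ (Finset.mem_univ j), mulVec_transpose_apply, hm, one_mul] at h0
  have hj : (k : ℤ) ∣ w j := by
    rw [eq_neg_of_add_eq_zero_left h0, dvd_neg]
    exact Finset.dvd_sum fun i hi =>
      (Int.natCast_dvd_natCast.2 (hk i (Finset.ne_of_mem_erase hi))).mul_left _
  have hall : ∀ i, (k : ℤ) ∣ w i := fun i => by
    rcases eq_or_ne i j with rfl | hi
    · exact hj
    · exact Int.natCast_dvd_natCast.2 (hk i hi)
  obtain ⟨x, hx⟩ := φ.surjective 1
  obtain ⟨a, rfl⟩ := Submodule.Quotient.mk_surjective _ x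
  rw [map_mk_eq_sum hφ] at hx
  have h1 : (k : ℤ) ∣ 1 := hx ▸ Finset.dvd_sum fun i _ => (hall i).mul_left _
  exact Nat.dvd_one.1 (by exact_mod_cast h1)

end ClassGroup

/-! ### Realizing well-formed weights by a simplex -/

section Existence

variable {w : Fin (n + 1) → ℕ}

/-- The linear form on `ℤ ^ (n + 1)` with coefficients `w`. -/
def weightForm (w : Fin (n + 1) → ℕ) : (Fin (n + 1) → ℤ) →ₗ[ℤ] ℤ :=
  Fintype.linearCombination ℤ fun i => (w i : ℤ)

theorem weightForm_apply (w : Fin (n + 1) → ℕ) (a : Fin (n + 1) → ℤ) :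
    weightForm w a = ∑ i, a i * (w i : ℤ) := by
  simp [weightForm, Fintype.linearCombination_apply]

theorem IsWellFormed.exists_sum_eq_one (hw : IsWellFormed w) (j : Fin (n + 1)) :
    ∃ a : Fin (n + 1) → ℤ, a j = 0 ∧ weightForm w a = 1 := by
  set I : Ideal ℤ := Ideal.span ((fun i => (w i : ℤ)) '' {i | i ≠ j}) with hI
  obtain ⟨g, hg⟩ := IsPrincipalIdealRing.principal I
  have hdvd : ∀ i, i ≠ j → g.natAbs ∣ w i := fun i hi => by
    have : g ∣ (w i : ℤ) := Ideal.mem_span_singleton.1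
      (hg.le <| Ideal.subset_span ⟨i, hi, rfl⟩)
    exact Int.natCast_dvd_natCast.1 (by simpa using this)
  have h1 : (1 : ℤ) ∈ I := by
    rw [hg]
    exact Ideal.mem_span_singleton.2 (Int.isUnit_iff_natAbs_eq.2 (hw j _ hdvd)).dvd
  obtain ⟨l, hl, hl1⟩ := (Finsupp.mem_span_image_iff_linearCombination ℤ).1 h1
  refine ⟨l, ?_, ?_⟩
  · by_contra h
    exact (Finsupp.mem_supported _ _).1 hl (Finsupp.mem_support_iff.2 h) rfl
  · rw [weightForm_apply, ← hl1, Finsupp.linearCombination_apply, Finsupp.sum_fintype _ _ (by simp)]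
    simp

theorem IsWellFormed.surjective_weightForm (hw : IsWellFormed w) :
    Function.Surjective (weightForm w) := by
  obtain ⟨a, -, ha⟩ := hw.exists_sum_eq_one 0
  exact fun t => ⟨t • a, by rw [map_smul, ha, smul_eq_mul, mul_one]⟩

theorem IsWellFormed.finrank_ker (hw : IsWellFormed w) :
    Module.finrank ℤ (LinearMap.ker (weightForm w)) = n := by
  have h := Submodule.finrank_quotient_add_finrank (LinearMap.ker (weightForm w))
  rw [((weightForm w).quotKerEquivOfSurjective hw.surjective_weightForm).finrank_eq] at h
  simp at h
  omega

/-- The integral matrix whose transpose parametrizes the kernel of a well-formed weight form. -/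
theorem IsWellFormed.exists_rows (hw : IsWellFormed w) :
    ∃ v : Fin (n + 1) → Fin n → ℤ, ∀ a : Fin (n + 1) → ℤ,
      (∃ m : Fin n → ℤ, ∀ i, m ⬝ᵥ v i = a i) ↔ weightForm w a = 0 := by
  let B := Module.finBasisOfFinrankEq ℤ (LinearMap.ker (weightForm w)) hw.finrank_ker
  have key : ∀ (m : Fin n → ℤ) (i : Fin (n + 1)),
      m ⬝ᵥ (fun k => (B k : Fin (n + 1) → ℤ) i) =
        ((∑ k, m k • B k : LinearMap.ker (weightForm w)) : Fin (n + 1) → ℤ) i := by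
    intro m i
    simp [dotProduct]
  refine ⟨fun i k => (B k : Fin (n + 1) → ℤ) i, fun a => ⟨?_, fun ha => ?_⟩⟩
  · rintro ⟨m, hm⟩
    have : a = ((∑ k, m k • B k : LinearMap.ker (weightForm w)) : Fin (n + 1) → ℤ) :=
      funext fun i => by rw [← hm, key]
    rw [this]
    exact LinearMap.mem_ker.1 (Subtype.property _)
  · refine ⟨B.repr ⟨a, ha⟩, fun i => ?_⟩
    rw [key, B.sum_repr]

/-- The vector w_j e_i - w_i e_j lies in the kernel of `w`, so it consists of the values of a
character on the `v k`. Applying that character to the real relation leaves only the terms `i` and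
`j`. -/
theorem eq_of_dotProduct_eq_weightForm {v : Fin (n + 1) → Fin n → ℤ}
    (hv : ∀ a : Fin (n + 1) → ℤ, weightForm w a = 0 → ∃ m : Fin n → ℤ, ∀ i, m ⬝ᵥ v i = a i)
    {c : Fin (n + 1) → ℝ} (hc : ∑ i, c i • (fun a => (v i a : ℝ) : Fin n → ℝ) = 0)
    (i j : Fin (n + 1)) : c i * w j = c j * w i := by
  obtain ⟨m, hm⟩ := hv (Pi.single i (w j : ℤ) - Pi.single j (w i : ℤ)) (by
    rw [map_sub]
    simp [weightForm, mul_comm])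
  have h0 : ∑ k, c k * ((m ⬝ᵥ v k : ℤ) : ℝ) = 0 := by
    have := congrArg (fun x => (fun a => (m a : ℝ)) ⬝ᵥ x) hc
    simp only [dotProduct_sum, dotProduct_smul, dotProduct_zero, smul_eq_mul] at this
    rw [← this]
    simp [dotProduct]
  simp only [hm, Pi.sub_apply, Int.cast_sub, mul_sub, Finset.sum_sub_distrib] at h0
  rw [Finset.sum_eq_single i (fun k _ hk => by simp [hk]) (by simp),
    Finset.sum_eq_single j (fun k _ hk => by simp [hk]) (by simp)] at h0
  simp at h0
  linarith

theorem IsWellFormed.exists_fakeWPS (hw : IsWellFormed w) (hpos : ∀ i, 1 ≤ w i) :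
    ∃ (Z : FakeWPS n) (φ : Z.Cl ≃ₗ[ℤ] ℤ), ∀ i, φ (Z.ω i) = (w i : ℤ) := by
  obtain ⟨v, hv⟩ := hw.exists_rows
  set V : Fin (n + 1) → Fin n → ℝ := fun i => (fun a => (v i a : ℝ)) with hV
  have hpos' : ∀ i, (0 : ℝ) < w i := fun i => by exact_mod_cast hpos i
  have hprop : ∀ {c : Fin (n + 1) → ℝ}, ∑ i, c i • V i = 0 → ∀ i j, c i * w j = c j * w i :=
    fun hc => eq_of_dotProduct_eq_weightForm (fun a => (hv a).2) hc
  have hprim : ∀ (i : Fin (n + 1)) (k : ℤ) (u : Fin n → ℤ), v i = k • u → IsUnit k := by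
    intro i k u hu
    obtain ⟨a, ha, ha1⟩ := hw.exists_sum_eq_one i
    -- A vector of degree zero with `i`-th entry 1, since `a i = 0`: some character takes the value
    -- 1 on `v i`.
    obtain ⟨m, hm⟩ := (hv (Pi.single i 1 - (w i : ℤ) • a)).2 (by
      rw [map_sub, map_smul, ha1]
      simp [weightForm])
    have h := hm i
    rw [hu, dotProduct_smul] at h
    simp only [Pi.sub_apply, Pi.single_eq_same, Pi.smul_apply, ha, smul_zero, sub_zero] at h
    exact IsUnit.of_mul_eq_one _ h
  have hsumpos : (0 : ℝ) < ∑ i, (w i : ℝ) := Finset.sum_pos (fun i _ => hpos' i) (by simp)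
  have haff : AffineIndependent ℝ V := by
    rw [affineIndependent_iff_of_fintype]
    intro c hc hcV i
    rw [Finset.weightedVSub_eq_linear_combination _ hc] at hcV
    -- Summing the proportionality over `j`, with `∑ c j = 0`, forces `c i = 0`.
    have h1 : ∑ j, c i * (w j : ℝ) = ∑ j, c j * (w i : ℝ) :=
      Finset.sum_congr rfl fun j _ => hprop hcV i j
    rw [← Finset.mul_sum, ← Finset.sum_mul, hc, zero_mul] at h1
    exact (mul_eq_zero.1 h1).resolve_right hsumpos.ne'
  have hrel : ∑ i, (w i : ℝ) • V i = 0 := by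
    ext a
    have h := (hv fun i => v i a).1 ⟨Pi.single a 1, fun i => by simp⟩
    rw [weightForm_apply] at h
    have h' := congrArg (Int.cast : ℤ → ℝ) h
    push_cast at h'
    simpa [hV, mul_comm] using h'
  have hint : (0 : Fin n → ℝ) ∈ interior (convexHull ℝ (Set.range V)) := by
    let b : AffineBasis (Fin (n + 1)) ℝ (Fin n → ℝ) :=
      ⟨V, haff, haff.affineSpan_eq_top_iff_card_eq_finrank_add_one.2 (by simp)⟩
    have hb : Set.range V = Set.range b := rfl
    rw [hb, b.interior_convexHull]
    intro i
    -- The normalized weights are the barycentric coordinates of the origin, and they are positive.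
    have hone : ∑ j, (w j : ℝ) / ∑ k, (w k : ℝ) = 1 := by
      rw [← Finset.sum_div, div_self hsumpos.ne']
    have h0 : (0 : Fin n → ℝ) =
        Finset.univ.affineCombination ℝ b fun j => (w j : ℝ) / ∑ k, (w k : ℝ) := by
      rw [Finset.affineCombination_eq_linear_combination _ _ _ hone]
      have : ∀ j, ((w j : ℝ) / ∑ k, (w k : ℝ)) • b j = (∑ k, (w k : ℝ))⁻¹ • ((w j : ℝ) • V j) :=
        fun j => by rw [smul_smul, div_eq_inv_mul]; rfl
      simp only [this]
      rw [← Finset.smul_sum, hrel, smul_zero]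
    rw [h0, b.coord_apply_combination_of_mem (Finset.mem_univ i) hone]
    exact div_pos (hpos' i) hsumpos
  let Z : FakeWPS n := ⟨v, hprim, haff, hint⟩
  have hker : LinearMap.range (Matrix.mulVecLin Z.Pᵀ) = LinearMap.ker (weightForm w) := by
    ext a
    rw [LinearMap.mem_ker, ← hv a]
    refine exists_congr fun m => ?_
    rw [funext_iff]
    refine forall_congr' fun i => ?_
    rw [Matrix.mulVecLin_apply, mulVec_transpose_apply]
  refine ⟨Z, (Submodule.quotEquivOfEq _ _ hker).trans
    ((weightForm w).quotKerEquivOfSurjective hw.surjective_weightForm), fun i => ?_⟩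
  change weightForm w (Pi.single i 1) = w i
  simp [weightForm]

end Existence

theorem mem_nefWeightPairs_iff {s : ℕ} (w : Fin (n + 1) → ℕ)
    (S : Set (Finpartition (Finset.univ : Finset (Fin (n + 1))))) :
    (w, S) ∈ nefWeightPairs n s ↔
      (∀ i, 1 ≤ w i) ∧ Monotone w ∧ IsWellFormed w ∧ S.Nonempty ∧
        S = {p | p.parts.card = s ∧
          ∀ b ∈ p.parts, ∀ i, w i ∣ ∑ j ∈ b, w j ∧ ∑ j ∈ b, w j ≠ w i} := by
  have key : ∀ (Z : FakeWPS n) (φ : Z.Cl ≃ₗ[ℤ] ℤ), (∀ i, φ (Z.ω i) = (w i : ℤ)) →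
      Z.nefPartitions s = {p | p.parts.card = s ∧
          ∀ b ∈ p.parts, ∀ i, w i ∣ ∑ j ∈ b, w j ∧ ∑ j ∈ b, w j ≠ w i} := fun Z φ hφ =>
    Set.ext fun p => and_congr_right fun _ => isNefPartition_iff hφ p
  constructor
  · rintro ⟨Z, ⟨hpos, hmono, φ, hφ⟩, hne, hS⟩
    dsimp only at hpos hmono hφ hS
    exact ⟨hpos, hmono, isWellFormed_of_map hφ, hS ▸ hne, hS.trans (key Z φ hφ)⟩
  · rintro ⟨hpos, hmono, hw, hne, hS⟩
    obtain ⟨Z, φ, hφ⟩ := hw.exists_fakeWPS hpos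
    have hSZ := hS.trans (key Z φ hφ).symm
    exact ⟨Z, ⟨hpos, hmono, φ, hφ⟩, hSZ ▸ hne, hSZ⟩

end FakeWPS

theorem exists_antitone_enumeration {α β : Type*} [DecidableEq α] [LinearOrder β] {s : ℕ}
    (S : Finset α) (hS : S.card = s) (key : α → β) :
    ∃ b : Fin s → α, Function.Injective b ∧ Finset.univ.image b = S ∧ Antitone (key ∘ b) := by
  let e := (S.equivFinOfCardEq hS).symm
  let σ := Tuple.sort fun i => OrderDual.toDual (key (e i))
  refine ⟨fun i => e (σ i), fun i j h => σ.injective (e.injective (Subtype.ext h)), ?_, ?_⟩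
  · ext a
    simp only [Finset.mem_image, Finset.mem_univ, true_and]
    constructor
    · rintro ⟨i, rfl⟩
      exact (e (σ i)).2
    · intro ha
      exact ⟨σ.symm (e.symm ⟨a, ha⟩), by simp⟩
  · exact fun i j hij => Tuple.monotone_sort (fun i => OrderDual.toDual (key (e i))) hij

/-! ### Stored vectors and partitions -/

namespace NefProcedure

theorem sum_map_const_mul (c : ℕ) (l : List ℕ) : (l.map (c * ·)).sum = c * l.sum := by
  simpa using List.sum_map_mul_left (l := l) (f := id) (r := c)

theorem lcmOf_dvd_iff {l : List ℕ} {a : ℕ} : lcmOf l ∣ a ↔ ∀ x ∈ l, x ∣ a :=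
  Multiset.lcm_dvd

theorem le_maxOf {l : List ℕ} {x : ℕ} (hx : x ∈ l) : x ≤ maxOf l :=
  Multiset.le_sup (Multiset.mem_coe.2 hx)

theorem mul_maxOf_lt {l : List ℕ} {c N : ℕ} (hN : 0 < N) (hc : 0 < c)
    (h : ∀ x ∈ l, c * x < N) : c * maxOf l < N := by
  -- The non-strict bound also covers the empty list, whose maximum is 0.
  have hle : maxOf l ≤ (N - 1) / c := Multiset.sup_le.2 fun x hx => by
    have := h x (Multiset.mem_coe.1 hx)
    rw [Nat.le_div_iff_mul_le hc, mul_comm]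
    omega
  rw [Nat.le_div_iff_mul_le hc, mul_comm] at hle
  omega

theorem mul_lcmOf_dvd {l : List ℕ} {c N : ℕ} (hc : c ∣ N) (h : ∀ x ∈ l, c * x ∣ N) :
    c * lcmOf l ∣ N := by
  rcases Nat.eq_zero_or_pos c with rfl | hc0
  · simpa using hc
  obtain ⟨M, rfl⟩ := hc
  exact mul_dvd_mul_left c (lcmOf_dvd_iff.2 fun x hx => (Nat.mul_dvd_mul_iff_left hc0).1 (h x hx))

theorem sum_pos_of_mem_blocks {k : ℕ} {l : List ℕ} (hk : 1 ≤ k) (hl : l ∈ blocks k) :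
    0 < l.sum := by
  obtain ⟨hlen, hpos, -⟩ := hl
  obtain ⟨x, hx⟩ := List.exists_mem_of_length_pos (by omega : 0 < l.length)
  exact (hpos x hx).trans (List.single_le_sum (by simp) x hx)

section Stores

variable {n s : ℕ} {W : Fin s → List ℕ} {c : Fin s → ℕ} {w : Fin (n + 1) → ℕ}

theorem sum_scaledBlock (i : Fin s) : (scaledBlock W c i).sum = c i * (W i).sum := by
  rw [scaledBlock, Multiset.sum_coe, sum_map_const_mul]

theorem mem_scaledBlock {i : Fin s} {y : ℕ} :
    y ∈ scaledBlock W c i ↔ ∃ x ∈ W i, c i * x = y := by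
  simp [scaledBlock]

theorem sum_eq_of_map_eq {t : Finset (Fin (n + 1))} {i : Fin s}
    (ht : t.val.map w = scaledBlock W c i) : ∑ j ∈ t, w j = c i * (W i).sum := by
  rw [← sum_scaledBlock, ← ht]
  rfl

theorem exists_mem_of_map_eq {t : Finset (Fin (n + 1))} {i : Fin s}
    (ht : t.val.map w = scaledBlock W c i) {j : Fin (n + 1)} (hj : j ∈ t) :
    ∃ x ∈ W i, c i * x = w j := by
  rw [← mem_scaledBlock, ← ht]
  exact Multiset.mem_map_of_mem w hj

theorem exists_index_of_map_eq {t : Finset (Fin (n + 1))} {i : Fin s}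
    (ht : t.val.map w = scaledBlock W c i) {x : ℕ} (hx : x ∈ W i) :
    ∃ j ∈ t, w j = c i * x := by
  have : c i * x ∈ t.val.map w := ht ▸ mem_scaledBlock.2 ⟨x, hx, rfl⟩
  simpa using this

theorem card_eq_of_map_eq {t : Finset (Fin (n + 1))} {i : Fin s}
    (ht : t.val.map w = scaledBlock W c i) : t.card = (W i).length := by
  simpa [scaledBlock] using congrArg Multiset.card ht

theorem exists_block_of_image_eq {p : Finpartition (Finset.univ : Finset (Fin (n + 1)))}
    {b : Fin s → Finset (Fin (n + 1))} (hb : Finset.univ.image b = p.parts) (j : Fin (n + 1)) :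
    ∃ i, j ∈ b i := by
  obtain ⟨t, ht, hj⟩ := p.exists_mem (Finset.mem_univ j)
  rw [← hb] at ht
  obtain ⟨i, -, rfl⟩ := Finset.mem_image.1 ht
  exact ⟨i, hj⟩

variable {d : Fin s → ℕ} {p : Finpartition (Finset.univ : Finset (Fin (n + 1)))}

theorem Stores.one_le (hW : W ∈ blockTuples d) (hc : c ∈ multipliers W) (h : Stores W c w p)
    (j : Fin (n + 1)) : 1 ≤ w j := by
  obtain ⟨-, -, b, -, hb, hbw⟩ := h
  obtain ⟨i, hi⟩ := exists_block_of_image_eq hb j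
  obtain ⟨x, hx, hxj⟩ := exists_mem_of_map_eq (hbw i) hi
  rw [← hxj]
  exact Nat.mul_pos (hc.1 i) ((hW.1 i).2.1 x hx)

theorem Stores.dvd_and_lt (hc : c ∈ multipliers W) (h : Stores W c w p)
    {t : Finset (Fin (n + 1))} (ht : t ∈ p.parts) (j : Fin (n + 1)) :
    w j ∣ ∑ k ∈ t, w k ∧ w j < ∑ k ∈ t, w k := by
  obtain ⟨-, -, b, -, hb, hbw⟩ := h
  obtain ⟨-, -, -, hdvd, hlt⟩ := hc
  obtain ⟨i, hi⟩ := exists_block_of_image_eq hb j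
  obtain ⟨x, hx, hxj⟩ := exists_mem_of_map_eq (hbw i) hi
  rw [← hb] at ht
  obtain ⟨k, -, rfl⟩ := Finset.mem_image.1 ht
  rw [sum_eq_of_map_eq (hbw k), ← hxj]
  exact ⟨(mul_dvd_mul_left _ (lcmOf_dvd_iff.1 dvd_rfl x hx)).trans (hdvd i k),
    (Nat.mul_le_mul_left _ (le_maxOf hx)).trans_lt (hlt k i)⟩

theorem Stores.card_parts (h : Stores W c w p) : p.parts.card = s := by
  obtain ⟨-, -, b, hinj, hb, -⟩ := h
  rw [← hb, Finset.card_image_of_injective _ hinj, Finset.card_fin]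

theorem Stores.isWellFormed (hd : ∀ i, 2 ≤ d i) (hW : W ∈ blockTuples d)
    (hc : c ∈ multipliers W) (h : Stores W c w p) : FakeWPS.IsWellFormed w := by
  intro j k hk
  have hdvd : ∀ t ∈ p.parts, ∀ j, w j ∣ ∑ k ∈ t, w k := fun t ht j => (h.dvd_and_lt hc ht j).1
  obtain ⟨-, -, b, -, hb, hbw⟩ := h
  obtain ⟨i₀, hi₀⟩ := exists_block_of_image_eq hb j
  have hmem : b i₀ ∈ p.parts := hb ▸ Finset.mem_image_of_mem b (Finset.mem_univ i₀)
  have hcard : 1 < (b i₀).card := by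
    rw [card_eq_of_map_eq (hbw i₀), (hW.1 i₀).1]
    exact hd i₀
  obtain ⟨j', hj', hne⟩ := Finset.exists_mem_ne hcard j
  -- The block of `j` has a second index `j'`, and `k ∣ w j'` divides the block sum; all its other
  -- summands are divisible by `k`, so `w j` is too.
  have hj : k ∣ w j := by
    have h1 : k ∣ ∑ l ∈ b i₀, w l := (hk j' hne).trans (hdvd _ hmem j')
    rw [← Finset.add_sum_erase _ _ hi₀] at h1
    exact (Nat.dvd_add_left (Finset.dvd_sum fun l hl => hk l (Finset.ne_of_mem_erase hl))).1 h1
  have hall : ∀ l, k ∣ w l := fun l => by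
    rcases eq_or_ne l j with rfl | hl
    · exact hj
    · exact hk l hl
  -- Each `W i` is primitive, so the gcd of the entries of `c i • W i` is `c i`.
  have hcdvd : k ∣ Finset.univ.gcd c := Finset.dvd_gcd fun i _ => by
    have h1 : k ∣ ((W i : Multiset ℕ).map fun x => c i * x).gcd := Multiset.dvd_gcd.2 fun y hy => by
      obtain ⟨x, hx, rfl⟩ := Multiset.mem_map.1 hy
      obtain ⟨l, -, hl⟩ := exists_index_of_map_eq (hbw i) (Multiset.mem_coe.1 hx)
      exact hl ▸ hall l
    have h2 : (W i : Multiset ℕ).gcd = 1 := (hW.1 i).2.2.2.1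
    rw [Multiset.gcd_map_mul, h2] at h1
    simpa using h1
  rw [hc.2.1] at hcdvd
  exact Nat.dvd_one.1 hcdvd

end Stores

/-! ### From nef-partitions to blocks and multipliers -/

section Reduction

variable {n s : ℕ} (w : Fin (n + 1) → ℕ)

/-- The primitive non-decreasing tuple proportional to the weights indexed by `t`. -/
def primitiveBlock (t : Finset (Fin (n + 1))) : List ℕ :=
  (t.val.map fun j => w j / t.gcd w).sort (· ≤ ·)

variable {w}

theorem coe_primitiveBlock (t : Finset (Fin (n + 1))) :
    (primitiveBlock w t : Multiset ℕ) = t.val.map fun j => w j / t.gcd w :=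
  Multiset.sort_eq _ _

theorem mem_primitiveBlock {t : Finset (Fin (n + 1))} {x : ℕ} :
    x ∈ primitiveBlock w t ↔ ∃ j ∈ t, w j / t.gcd w = x := by
  rw [← Multiset.mem_coe, coe_primitiveBlock]
  simp

theorem length_primitiveBlock (t : Finset (Fin (n + 1))) :
    (primitiveBlock w t).length = t.card := by
  simp [primitiveBlock]

theorem map_mul_primitiveBlock (t : Finset (Fin (n + 1))) :
    (((primitiveBlock w t).map (t.gcd w * ·) : List ℕ) : Multiset ℕ) = t.val.map w := by
  rw [← Multiset.map_coe, coe_primitiveBlock, Multiset.map_map]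
  exact Multiset.map_congr rfl fun j hj => Nat.mul_div_cancel' (Finset.gcd_dvd hj)

theorem gcd_mul_sum_primitiveBlock (t : Finset (Fin (n + 1))) :
    t.gcd w * (primitiveBlock w t).sum = ∑ j ∈ t, w j := by
  rw [← sum_map_const_mul, ← Multiset.sum_coe]
  exact congrArg Multiset.sum (map_mul_primitiveBlock t)

theorem gcd_pos {t : Finset (Fin (n + 1))} (hpos : ∀ i, 1 ≤ w i) (ht : t.Nonempty) :
    0 < t.gcd w := by
  obtain ⟨j, hj⟩ := ht
  exact Nat.pos_of_dvd_of_pos (Finset.gcd_dvd hj) (hpos j)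

theorem exists_mem_of_mem_primitiveBlock {t : Finset (Fin (n + 1))} {x : ℕ}
    (hx : x ∈ primitiveBlock w t) : ∃ j ∈ t, t.gcd w * x = w j := by
  obtain ⟨j, hj, rfl⟩ := mem_primitiveBlock.1 hx
  exact ⟨j, hj, Nat.mul_div_cancel' (Finset.gcd_dvd hj)⟩

theorem primitiveBlock_mem_blocks {t : Finset (Fin (n + 1))} (hpos : ∀ i, 1 ≤ w i)
    (ht : t.Nonempty) (hdvd : ∀ j ∈ t, w j ∣ ∑ k ∈ t, w k) :
    primitiveBlock w t ∈ blocks t.card := by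
  have hg := gcd_pos hpos ht
  refine ⟨length_primitiveBlock t, fun x hx => ?_, Multiset.pairwise_sort _ _, ?_, ?_⟩
  · obtain ⟨j, -, hj⟩ := exists_mem_of_mem_primitiveBlock hx
    exact Nat.pos_of_ne_zero fun h0 => Nat.one_ne_zero (Nat.le_zero.1 ((hpos j).trans (Nat.le_of_eq (by rw [← hj, h0, mul_zero]))))
  · have h1 : ((t.val.map fun j => w j / t.gcd w).map fun x => t.gcd w * x).gcd = t.gcd w := by
      rw [← coe_primitiveBlock, Multiset.map_coe, map_mul_primitiveBlock, Finset.gcd_def]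
    rw [Multiset.gcd_map_mul, ← coe_primitiveBlock] at h1
    exact Nat.eq_of_mul_eq_mul_left hg (by simpa [gcdOf] using h1)
  · refine lcmOf_dvd_iff.2 fun x hx => ?_
    obtain ⟨j, hj, hjx⟩ := exists_mem_of_mem_primitiveBlock hx
    rw [← Nat.mul_dvd_mul_iff_left hg, hjx, gcd_mul_sum_primitiveBlock]
    exact hdvd j hj

/-- With M the lcm, `c i` divides every `c j * M`, hence their gcd, which is M. This yields
condition (a) of the procedure. -/
theorem dvd_lcm_of_forall_dvd_mul {c S : Fin s → ℕ} (hgcd : Finset.univ.gcd c = 1)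
    {i : Fin s} (h : ∀ j, c i ∣ c j * S j) : c i ∣ (Finset.univ.erase i).lcm S := by
  have h1 : c i ∣ Finset.univ.gcd fun j => c j * (Finset.univ.erase i).lcm S :=
    Finset.dvd_gcd fun j _ => by
      rcases eq_or_ne j i with rfl | hj
      · exact dvd_mul_right _ _
      · exact (h j).trans (mul_dvd_mul_left _
          (Finset.dvd_lcm (Finset.mem_erase.2 ⟨hj, Finset.mem_univ j⟩)))
  rw [Finset.gcd_mul_right, hgcd] at h1
  simpa using h1

theorem sum_map_blocks {p : Finpartition (Finset.univ : Finset (Fin (n + 1)))}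
    {b : Fin s → Finset (Fin (n + 1))} (hinj : Function.Injective b)
    (hb : Finset.univ.image b = p.parts) {M : Type*} [AddCommMonoid M] (f : Fin (n + 1) → M) :
    ∑ i, ∑ j ∈ b i, f j = ∑ j, f j := by
  rw [← Finset.sum_image (f := fun t => ∑ j ∈ t, f j) hinj.injOn, hb]
  conv_rhs => rw [← p.biUnion_parts]
  rw [Finset.sum_biUnion p.disjoint]
  rfl

theorem mem_q_of_forall_dvd (hpos : ∀ i, 1 ≤ w i) (hmono : Monotone w)
    (hw : FakeWPS.IsWellFormed w) {p : Finpartition (Finset.univ : Finset (Fin (n + 1)))}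
    (hp : p.parts.card = s)
    (h : ∀ b ∈ p.parts, ∀ i, w i ∣ ∑ j ∈ b, w j ∧ ∑ j ∈ b, w j ≠ w i) : p ∈ q n s w := by
  -- Sorting by size first and by primitive block second gives the orderings of steps 2 and 3 at
  -- once.
  obtain ⟨b, hinj, hb, hanti⟩ := exists_antitone_enumeration p.parts hp
    fun t => toLex (t.card, primitiveBlock w t)
  have hmem : ∀ i, b i ∈ p.parts := fun i => hb ▸ Finset.mem_image_of_mem b (Finset.mem_univ i)
  have hne : ∀ i, (b i).Nonempty := fun i => p.nonempty_of_mem_parts (hmem i)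
  have hdvd : ∀ i j, w j ∣ ∑ k ∈ b i, w k := fun i j => (h _ (hmem i) j).1
  have hsum : ∀ i, 0 < ∑ k ∈ b i, w k := fun i => Finset.sum_pos (fun k _ => hpos k) (hne i)
  have hlt : ∀ i j, w j < ∑ k ∈ b i, w k := fun i j =>
    lt_of_le_of_ne (Nat.le_of_dvd (hsum i) (hdvd i j)) (h _ (hmem i) j).2.symm
  have hgpos : ∀ i, 0 < (b i).gcd w := fun i => gcd_pos hpos (hne i)
  have hgcd : Finset.univ.gcd (fun i => (b i).gcd w) = 1 := by
    refine hw 0 _ fun l _ => ?_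
    obtain ⟨i, hi⟩ := exists_block_of_image_eq hb l
    exact (Finset.gcd_dvd (Finset.mem_univ i)).trans (Finset.gcd_dvd hi)
  have hscaled : ∀ i, (b i).val.map w =
      scaledBlock (fun i => primitiveBlock w (b i)) (fun i => (b i).gcd w) i :=
    fun i => (map_mul_primitiveBlock (b i)).symm
  have hdvdS : ∀ i j, (b i).gcd w * lcmOf (primitiveBlock w (b i)) ∣
      (b j).gcd w * (primitiveBlock w (b j)).sum := by
    intro i j
    rw [gcd_mul_sum_primitiveBlock]
    obtain ⟨k, hk⟩ := hne i
    refine mul_lcmOf_dvd ((Finset.gcd_dvd hk).trans (hdvd j k)) fun x hx => ?_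
    obtain ⟨l, -, hl⟩ := exists_mem_of_mem_primitiveBlock hx
    exact hl ▸ hdvd j l
  refine ⟨fun i => (b i).card, ⟨fun i j hij => ?_, fun i => ?_, ?_⟩,
    fun i => primitiveBlock w (b i), ⟨fun i => ?_, fun i j hij => ?_⟩,
    fun i => (b i).gcd w, ⟨hgpos, hgcd, fun i _ => ?_, hdvdS, fun i j => ?_⟩,
    hmono, ?_, b, hinj, hb, hscaled⟩
  · rcases Prod.Lex.toLex_le_toLex.1 (hanti hij) with hc | hc
    · exact hc.le
    · exact hc.1.le
  -- A one-element block would have its own weight as sum, against the strict inequality.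
  · by_contra hcard
    dsimp only at hcard
    have h1 := (hne i).card_pos
    obtain ⟨j, hj⟩ := Finset.card_eq_one.1 (by omega : (b i).card = 1)
    have := hlt i j
    rw [hj, Finset.sum_singleton] at this
    exact lt_irrefl _ this
  · simpa using sum_map_blocks hinj hb fun _ => (1 : ℕ)
  · exact primitiveBlock_mem_blocks hpos (hne i) fun j _ => hdvd i j
  · have hle : i ≤ j := Fin.le_def.2 (by omega)
    rcases Prod.Lex.toLex_le_toLex.1 (hanti hle) with hc | hc
    · exact Or.inl hc
    · exact Or.inr hc.2
  · exact dvd_lcm_of_forall_dvd_mul hgcd fun j => (dvd_mul_right _ _).trans (hdvdS i j)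
  · dsimp only
    rw [gcd_mul_sum_primitiveBlock]
    refine mul_maxOf_lt (hsum i) (hgpos j) fun x hx => ?_
    obtain ⟨l, -, hl⟩ := exists_mem_of_mem_primitiveBlock hx
    exact hl ▸ hlt i l
  · have h1 : ∀ t : Finset (Fin (n + 1)), t.val.map w = ∑ j ∈ t, {w j} := fun t => by
      rw [← Multiset.sum_map_singleton (t.val.map w), Multiset.map_map]
      rfl
    simp only [← hscaled, h1]
    rw [sum_map_blocks hinj hb]

end Reduction

theorem mem_q_iff {n s : ℕ} {w : Fin (n + 1) → ℕ} (hpos : ∀ i, 1 ≤ w i) (hmono : Monotone w)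
    (hw : FakeWPS.IsWellFormed w) (p : Finpartition (Finset.univ : Finset (Fin (n + 1)))) :
    p ∈ q n s w ↔ p.parts.card = s ∧
      ∀ b ∈ p.parts, ∀ i, w i ∣ ∑ j ∈ b, w j ∧ ∑ j ∈ b, w j ≠ w i := by
  refine ⟨?_, fun h => mem_q_of_forall_dvd hpos hmono hw h.1 h.2⟩
  rintro ⟨d, -, W, -, c, hc, h⟩
  exact ⟨h.card_parts, fun b hb i =>
    ⟨(h.dvd_and_lt hc hb i).1, (h.dvd_and_lt hc hb i).2.ne'⟩⟩

theorem output_eq_nefWeightPairs (n s : ℕ) : output n s = nefWeightPairs n s := by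
  ext ⟨w, S⟩
  rw [FakeWPS.mem_nefWeightPairs_iff]
  constructor
  · rintro ⟨⟨p, hp⟩, rfl : S = q n s w⟩
    have hp' := hp
    obtain ⟨d, hd, W, hW, c, hc, h⟩ := hp'
    have hpos := h.one_le hW hc
    have hw := h.isWellFormed hd.2.1 hW hc
    exact ⟨hpos, h.1, hw, ⟨p, hp⟩, Set.ext fun p => mem_q_iff hpos h.1 hw p⟩
  · rintro ⟨hpos, hmono, hw, hne, hS⟩
    have hSq : S = q n s w := hS.trans (Set.ext fun p => (mem_q_iff hpos hmono hw p).symm)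
    exact ⟨hSq ▸ hne, hSq⟩

end NefProcedure

/-! ### Finiteness -/

namespace NefProcedure

/-- The tuples of positive integers with reciprocal sum one form an antichain, so there are only
finitely many of them by Dickson's lemma. -/
theorem finite_setOf_sum_inv_eq_one (k : ℕ) :
    {a : Fin k → ℕ | (∀ i, 1 ≤ a i) ∧ ∑ i, (a i : ℚ)⁻¹ = 1}.Finite := by
  refine WellQuasiOrderedLE.finite_of_isAntichain ?_
  rintro a ⟨ha, hasum⟩ b ⟨hb, hbsum⟩ hne hle
  have hpos : ∀ i, (0 : ℚ) < a i := fun i => by exact_mod_cast ha i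
  have hinv : ∀ i ∈ Finset.univ, (b i : ℚ)⁻¹ ≤ (a i : ℚ)⁻¹ := fun i _ =>
    inv_anti₀ (hpos i) (by exact_mod_cast hle i)
  have heq := (Finset.sum_eq_sum_iff_of_le hinv).1 (hbsum.trans hasum.symm)
  exact hne (funext fun i => by exact_mod_cast (inv_injective (heq i (Finset.mem_univ i))).symm)

/-- The tuple of quotients S / x lies in the finite set of unit fraction decompositions of 1, and a
primitive tuple can be recovered from it. -/
theorem blocks_finite (k : ℕ) : (blocks k).Finite := by
  refine Set.Finite.of_finite_image (f := fun l => fun i : Fin k => l.sum / l.getD i 0)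
    ((finite_setOf_sum_inv_eq_one k).subset ?_) ?_
  · rintro _ ⟨l, hl, rfl⟩
    obtain ⟨rfl, hpos, -, -, hdvd⟩ := id hl
    have hx : ∀ i : Fin l.length, l.getD i 0 ∣ l.sum ∧ 0 < l.getD i 0 ∧ l.getD i 0 ≤ l.sum := by
      intro i
      have hm : l.getD i 0 ∈ l := by simp
      exact ⟨lcmOf_dvd_iff.1 hdvd _ hm, hpos _ hm, List.single_le_sum (by simp) _ hm⟩
    refine ⟨fun i => Nat.div_pos (hx i).2.2 (hx i).2.1, ?_⟩
    rcases Nat.eq_zero_or_pos l.length with h0 | h0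
    -- The empty tuple has gcd 0, so it is not primitive.
    · obtain rfl := List.length_eq_zero_iff.1 h0
      simp [blocks, gcdOf] at hl
    have hS : (l.sum : ℚ) ≠ 0 := by exact_mod_cast (sum_pos_of_mem_blocks h0 hl).ne'
    have hterm : ∀ i : Fin l.length,
        ((l.sum / l.getD i 0 : ℕ) : ℚ)⁻¹ = (l.getD i 0 : ℚ) / l.sum := fun i => by
      rw [Nat.cast_div (hx i).1 (by exact_mod_cast (hx i).2.1.ne'), inv_div]
    simp only [hterm]
    rw [← Finset.sum_div, div_eq_one_iff_eq hS, ← Nat.cast_sum]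
    congr 1
    simp [Fin.sum_univ_getElem]
  · rintro l hl l' hl' h
    obtain ⟨hlen, hpos, -, hgcd, hdvd⟩ := hl
    obtain ⟨hlen', hpos', -, hgcd', hdvd'⟩ := id hl'
    have hcross : l.map (l'.sum * ·) = l'.map (l.sum * ·) := by
      refine List.ext_getElem (by simp [hlen, hlen']) fun i h1 h2 => ?_
      simp only [List.length_map] at h1 h2
      have hi := congrFun h ⟨i, hlen ▸ h1⟩
      simp only [List.getD_eq_getElem _ _ h1, List.getD_eq_getElem _ _ h2] at hi
      have hd := lcmOf_dvd_iff.1 hdvd _ (List.getElem_mem h1)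
      have hd' := lcmOf_dvd_iff.1 hdvd' _ (List.getElem_mem h2)
      simp only [List.getElem_map]
      calc l'.sum * l[i] = l'.sum / l'[i] * l'[i] * l[i] := by rw [Nat.div_mul_cancel hd']
        _ = l.sum / l[i] * l[i] * l'[i] := by rw [hi]; ring
        _ = l.sum * l'[i] := by rw [Nat.div_mul_cancel hd]
    -- By primitivity, the gcds of the two sides of `hcross` are the two sums.
    have hsum : l'.sum = l.sum := by
      have := congrArg gcdOf hcross
      simp only [gcdOf, ← Multiset.map_coe, Multiset.gcd_map_mul] at this hgcd hgcd'
      simpa [hgcd, hgcd'] using this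
    rcases Nat.eq_zero_or_pos k with rfl | hk
    · rw [List.length_eq_zero_iff.1 hlen, List.length_eq_zero_iff.1 hlen']
    have hS := sum_pos_of_mem_blocks hk hl'
    rw [← hsum] at hcross
    exact List.map_injective_iff.2 (fun x y hxy => Nat.eq_of_mul_eq_mul_left hS hxy) hcross

theorem sizes_finite (n s : ℕ) : (sizes n s).Finite := by
  refine (Set.finite_Iic fun _ : Fin s => n + 1).subset ?_
  rintro d ⟨-, -, hd⟩ i
  exact hd ▸ Finset.single_le_sum (fun _ _ => Nat.zero_le _) (Finset.mem_univ i)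

theorem blockTuples_finite {s : ℕ} (d : Fin s → ℕ) : (blockTuples d).Finite :=
  (Set.Finite.pi' fun i => blocks_finite (d i)).subset fun _ hW => hW.1

theorem multipliers_finite {s : ℕ} {d : Fin s → ℕ} (hd : ∀ i, 2 ≤ d i) {W : Fin s → List ℕ}
    (hW : W ∈ blockTuples d) : (multipliers W).Finite := by
  rcases Nat.eq_zero_or_pos s with rfl | hs
  · exact Set.toFinite _
  have hS : ∀ i, 0 < (W i).sum := fun i =>
    sum_pos_of_mem_blocks (one_le_two.trans (hd i)) (hW.1 i)
  let i₀ : Fin s := ⟨0, hs⟩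
  set M := (Finset.univ.erase i₀).lcm fun j => (W j).sum with hM
  have hMpos : 0 < M := by
    refine Nat.pos_of_ne_zero fun h0 => ?_
    obtain ⟨j, -, hj⟩ := Finset.lcm_eq_zero_iff.1 h0
    exact (hS j).ne' hj
  refine (Set.finite_Iic fun _ : Fin s => M * (W i₀).sum).subset ?_
  -- (a) gives `c i₀ ≤ M`, and (c) bounds `c j` by `c i₀` times the sum of `W i₀`.
  rintro c ⟨-, -, ha, -, hlt⟩ j
  have h1 : c i₀ ≤ M := Nat.le_of_dvd hMpos (ha i₀ rfl)
  have hm : 1 ≤ maxOf (W j) := by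
    obtain ⟨hlen, hpos, -⟩ := hW.1 j
    obtain ⟨x, hx⟩ := List.exists_mem_of_length_pos (by have := hd j; omega : 0 < (W j).length)
    exact (hpos x hx).trans (le_maxOf hx)
  exact ((Nat.le_mul_of_pos_right _ hm).trans (hlt i₀ j).le).trans (Nat.mul_le_mul_right _ h1)

theorem output_finite (n s : ℕ) : (output n s).Finite := by
  have hfin : (⋃ d ∈ sizes n s, ⋃ W ∈ blockTuples d, ⋃ c ∈ multipliers W,
      Set.Iic fun _ : Fin (n + 1) => (∑ i, scaledBlock W c i).sum).Finite :=
    (sizes_finite n s).biUnion fun d hd => (blockTuples_finite d).biUnion fun W hW =>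
      (multipliers_finite hd.2.1 hW).biUnion fun c _ => Set.finite_Iic _
  refine (hfin.image fun w => (w, q n s w)).subset ?_
  rintro ⟨w, S⟩ ⟨⟨p, d, hd, W, hW, c, hc, hst⟩, rfl : S = q n s w⟩
  refine ⟨w, ?_, rfl⟩
  simp only [Set.mem_iUnion]
  refine ⟨d, hd, W, hW, c, hc, fun j => ?_⟩
  rw [← hst.2.1]
  exact Multiset.single_le_sum (fun _ _ => Nat.zero_le _) _
    (Multiset.mem_map_of_mem w (Finset.mem_univ j))

end NefProcedure

theorem mainTheorem6 (n s : ℕ) (hn : 1 ≤ n) (hs : 1 ≤ s) :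
    (∀ k : ℕ, 2 ≤ k → k ≤ n + 1 → (NefProcedure.blocks k).Finite) ∧
    (NefProcedure.sizes n s).Finite ∧
    (∀ d ∈ NefProcedure.sizes n s, (NefProcedure.blockTuples d).Finite) ∧
    (∀ d ∈ NefProcedure.sizes n s, ∀ W ∈ NefProcedure.blockTuples d,
      (NefProcedure.multipliers W).Finite) ∧
    (NefProcedure.output n s).Finite ∧
    NefProcedure.output n s = nefWeightPairs n s := by
  exact ⟨fun k _ _ => NefProcedure.blocks_finite k, NefProcedure.sizes_finite n s,
    fun d _ => NefProcedure.blockTuples_finite d,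
    fun _ hd _ hW => NefProcedure.multipliers_finite hd.2.1 hW,
    NefProcedure.output_finite n s, NefProcedure.output_eq_nefWeightPairs n s⟩
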